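/- Let $Q_n$ be the $n$-dimensional hypercube graph (vertices $\{0,1\}^n$, two vertices adjacent when they differ in exactly one coordinate) and let $C_{2k}$ be the cycle on $2k$ vertices. For a finite graph $G$ and graphs $T,H$, a copy of $T$ in $G$ is a (not necessarily induced) subgraph of $G$ isomorphic to $T$; let $N(G,T)$ be the number of copies of $T$ in $G$, let $\mathrm{ex}(G,T,H)$ be the maximum of $N(G',T)$ over all subgraphs $G'\subseteq G$ that contain no copy of $H$, and let $\mathbf{d}(G,T,H)=\mathrm{ex}(G,T,H)/N(G,T)$ (read as $0$ if $N(G,T)=0$). (a) For all integers $k\ge 2$ and $\ell,n\ge 0$ with $\ell\ge\log_2(2k)$, we have $\mathbf{d}(Q_n,Q_\ell,C_{2k})=0$. (b) For every integer $k\ge 4$ with $k\ne 5$ there is a constant $c_k>0$, depending only on $k$, such that for all integers $\ell,n$ with $2\le\ell<\log_2(2k)\le n$, and with $m=\lceil\log_2(2k)\rceil-1$, $$\binom{m}{\ell}\binom{n}{\ell}^{-1}\le \mathbf{d}(Q_n,Q_\ell,C_{2k})\le c_k\,n^{-1/16}.$$ -/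

import Mathlib

/-- The hypercube of dimension `n`: vertices are binary sequences of length `n`, and two of them
are adjacent when they differ in exactly one position. -/
def hypercube (n : ℕ) : SimpleGraph (Fin n → Bool) where
  Adj u v := hammingDist u v = 1
  symm := ⟨fun u v h => by rwa [hammingDist_comm]⟩
  loopless := ⟨fun u h => by simp at h⟩

open Classical in
/-- The generalized extremal number `ex(G, T, H)`: the largest number of copies of `T` (subgraphs
isomorphic to `T`) in an `H`-free subgraph `G'` of the finite graph `G`. -/
noncomputable def genExtremalNumber {V W U : Type*} [Fintype V]
    (G : SimpleGraph V) (T : SimpleGraph W) (H : SimpleGraph U) : ℕ :=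
  (Finset.univ.filter fun G' : G.Subgraph => H.Free G'.coe).sup fun G' => G'.coe.copyCount T

/-- The generalized Turán density `d(G, T, H) = ex(G, T, H) / N(G, T)`, where `N(G, T)` is the
number of copies of `T` in `G`. -/
noncomputable def genTuranDensity {V W U : Type*} [Fintype V]
    (G : SimpleGraph V) (T : SimpleGraph W) (H : SimpleGraph U) : ℝ :=
  (genExtremalNumber G T H : ℝ) / (G.copyCount T : ℝ)

/-! Every copy of `Q_ℓ` in `Q_n` is a subcube, so labelled copies are pairs of a base vertex and an
injection of directions, `2 ^ n * n.descFactorial ℓ` in all. Counts are made on labelled copies; the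
automorphism number of `Q_ℓ` cancels in the density.

Part (a): if `2k ≤ 2^ℓ`, then `Q_ℓ` itself contains `C_{2k}`, so a `C_{2k}`-free graph has no `Q_ℓ`.

Lower bound: the edges in the first `m` directions form disjoint copies of `Q_m`, each with `2^m <
2k` vertices, hence without `C_{2k}`. They contain `2 ^ n * m.descFactorial ℓ` labelled copies of
`Q_ℓ`.

Upper bound: at a vertex `v`, join two directions when the square they span at `v` lies in `G'`. A
path on `k` directions would chain `k - 1` squares into a `C_{2k}` through `v`, so this graph has at
most `2kn` ordered adjacent pairs. The first two directions of a labelled cube based at `v` form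
such a pair, and the others have at most `n` choices each. This gives density `O(1/n)`, which is at
most `O(n^{-1/16})`. -/

/-! ### Labelled and unlabelled copies -/

open SimpleGraph in
/-- Labelled copies of `A` in `B` are pairs of a copy of `A` and an automorphism of `A`. -/
theorem card_copy_eq_copyCount_mul {α β : Type*} [Fintype β]
    (A : SimpleGraph α) (B : SimpleGraph β) :
    Nat.card (Copy A B) = B.copyCount A * Nat.card (A ≃g A) := by
  classical
  let S := {B' : B.Subgraph // Nonempty (A ≃g B'.coe)}
  -- A labelled copy factors uniquely as an isomorphism onto its image followed by the inclusion.
  let F : (Σ B' : S, A ≃g B'.1.coe) → Copy A B := fun x => x.1.1.coeCopy.comp x.2.toCopy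
  have key : ∀ (B' : B.Subgraph) (e : A ≃g B'.coe),
      (B'.coeCopy.comp e.toCopy).toSubgraph = B' := by
    intro B' e
    have h : (B'.coeCopy.comp e.toCopy).toHom = B'.hom.comp e.toHom := rfl
    simp [Copy.toSubgraph, h, Subgraph.map_comp]
  have hF : Function.Bijective F := by
    constructor
    · rintro ⟨⟨B', hB'⟩, e⟩ ⟨⟨B'', hB''⟩, e'⟩ h
      have h1 : B' = B'' := by
        rw [← key B' e, ← key B'' e']
        exact congrArg Copy.toSubgraph h
      subst h1
      congr 1
      ext a
      exact congrArg (fun f : Copy A B => f a) h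
    · intro f
      refine ⟨⟨⟨f.toSubgraph, ⟨f.isoToSubgraph⟩⟩, f.isoToSubgraph⟩, ?_⟩
      ext a
      rfl
  -- A fixed reference isomorphism onto each image identifies all isomorphisms with automorphisms of
  -- `A`.
  let E (B' : S) : (A ≃g B'.1.coe) ≃ (A ≃g A) :=
    { toFun := fun e => e.trans B'.2.some.symm
      invFun := fun e => e.trans B'.2.some
      left_inv := fun e => by ext; simp
      right_inv := fun e => by ext; simp }
  rw [← Nat.card_congr (Equiv.ofBijective F hF),
    Nat.card_congr ((Equiv.sigmaCongrRight E).trans (Equiv.sigmaEquivProd _ _)), Nat.card_prod]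
  congr 1
  rw [copyCount, Nat.card_eq_fintype_card, Fintype.card_subtype]

/-! ### Bit flips and parametrized subcubes -/

section FlipBit
variable {ι κ : Type*} [DecidableEq ι]

/-- Flip the `i`-th bit of `v`. -/
def flipBit (v : ι → Bool) (i : ι) : ι → Bool := fun j => xor (v j) (decide (i = j))

theorem flipBit_apply (v : ι → Bool) (i j : ι) : flipBit v i j = xor (v j) (decide (i = j)) := rfl

theorem flipBit_injective (v : ι → Bool) : Function.Injective (flipBit v) := by
  intro i j h
  have := congrFun h i
  by_contra hij
  simp [flipBit_apply, Ne.symm hij] at this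

theorem flipBit_ne (v : ι → Bool) (i : ι) : flipBit v i ≠ v := by
  intro h
  have := congrFun h i
  simp [flipBit_apply] at this

theorem flipBit_flipBit_self (v : ι → Bool) (i : ι) : flipBit (flipBit v i) i = v := by
  funext j
  simp [flipBit_apply]

theorem flipBit_comm (v : ι → Bool) (i j : ι) :
    flipBit (flipBit v i) j = flipBit (flipBit v j) i := by
  funext l
  simp only [flipBit_apply, Bool.xor_assoc]
  rw [Bool.xor_comm (decide (i = l))]

/-- Two flips of `v` determine the pair of flipped positions. -/
theorem flipBit_flipBit_eq (v : ι → Bool) {i j a b : ι} (hij : i ≠ j)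
    (h : flipBit (flipBit v i) j = flipBit (flipBit v a) b) :
    (a = i ∧ b = j) ∨ (a = j ∧ b = i) := by
  have h1 := congrFun h i
  have h2 := congrFun h j
  simp only [flipBit_apply] at h1 h2
  by_cases ha : a = i <;> by_cases hb : b = j <;> by_cases hc : a = j <;> by_cases hd : b = i <;>
    simp_all

theorem flipBit_flipBit_ne (v : ι → Bool) {i j : ι} (hij : i ≠ j) :
    flipBit (flipBit v i) j ≠ v := by
  intro h
  have h1 := congrFun h i
  simp [flipBit_apply, hij.symm] at h1

theorem flipBit_flipBit_ne_flipBit (v : ι → Bool) (i j a : ι) :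
    flipBit (flipBit v i) j ≠ flipBit v a := by
  intro h
  by_cases hij : i = j
  · subst hij
    rw [flipBit_flipBit_self] at h
    exact flipBit_ne v a h.symm
  · have h1 := congrFun h i
    have h2 := congrFun h j
    simp only [flipBit_apply] at h1 h2
    by_cases ha : a = i <;> by_cases hb : a = j <;> simp_all

/-- The parametrization of the subcube through `v` in the directions `σ i`. -/
def subcubeMap (v : ι → Bool) (σ : κ ↪ ι) [Fintype κ] (x : κ → Bool) : ι → Bool :=
  fun j => xor (v j) (decide (∃ i, σ i = j ∧ x i = true))

theorem subcubeMap_false [Fintype κ] (v : ι → Bool) (σ : κ ↪ ι) :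
    subcubeMap v σ (fun _ => false) = v := by
  funext j
  simp [subcubeMap]

theorem subcubeMap_flipBit [Fintype κ] [DecidableEq κ] (v : ι → Bool) (σ : κ ↪ ι) (x : κ → Bool) (i : κ) :
    subcubeMap v σ (flipBit x i) = flipBit (subcubeMap v σ x) (σ i) := by
  funext j
  simp only [subcubeMap, flipBit_apply, Bool.xor_assoc]
  congr 1
  by_cases h : σ i = j
  · subst h
    simp only [EmbeddingLike.apply_eq_iff_eq, exists_eq_left]
    simp
  · have : (∃ i', σ i' = j ∧ (x i' ^^ decide (i = i')) = true) ↔ ∃ i', σ i' = j ∧ x i' = true := by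
      refine exists_congr fun i' => and_congr_right fun hi' => ?_
      have : i ≠ i' := by rintro rfl; exact h hi'
      simp [this]
    rw [Bool.eq_iff_iff]
    simp only [decide_eq_true_eq, h, decide_false, Bool.xor_false]
    exact decide_eq_true_iff.trans this

theorem subcubeMap_injective [Fintype κ] (v : ι → Bool) (σ : κ ↪ ι) :
    Function.Injective (subcubeMap v σ) := by
  intro x y h
  funext i
  have := congrFun h (σ i)
  simpa [subcubeMap] using this

end FlipBit

/-! ### Copies of a cube in a cube -/

theorem hypercube_adj_iff {n : ℕ} {u v : Fin n → Bool} :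
    (hypercube n).Adj u v ↔ ∃ i, v = flipBit u i := by
  change hammingDist u v = 1 ↔ _
  rw [hammingDist, Finset.card_eq_one]
  refine exists_congr fun i => ?_
  rw [Finset.ext_iff, funext_iff]
  refine forall_congr' fun j => ?_
  simp only [Finset.mem_filter, Finset.mem_univ, true_and, Finset.mem_singleton, flipBit_apply]
  by_cases h : j = i
  · subst h
    cases u j <;> cases v j <;> simp
  · have h' : ¬ i = j := fun e => h e.symm
    cases u j <;> cases v j <;> simp [h, h']

theorem hypercube_adj_flipBit {n : ℕ} (u : Fin n → Bool) (i : Fin n) :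
    (hypercube n).Adj u (flipBit u i) := hypercube_adj_iff.2 ⟨i, rfl⟩

open SimpleGraph in
/-- Every copy of a hypercube in a hypercube is a subcube. -/
theorem exists_eq_subcubeMap {ℓ n : ℕ} (f : Copy (hypercube ℓ) (hypercube n)) :
    ∃ σ : Fin ℓ ↪ Fin n, ∀ x, f x = subcubeMap (f fun _ => false) σ x := by
  have hadj : ∀ x i, ∃ j, f (flipBit x i) = flipBit (f x) j := fun x i =>
    hypercube_adj_iff.1 (f.toHom.map_adj (hypercube_adj_flipBit x i))
  have hinj : Function.Injective f := f.injective
  choose s hs using hadj (fun _ => false)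
  have hsinj : Function.Injective s := by
    intro i j h
    apply flipBit_injective (fun _ => false)
    apply hinj
    rw [hs, hs, h]
  refine ⟨⟨s, hsinj⟩, ?_⟩
  set σ : Fin ℓ ↪ Fin n := ⟨s, hsinj⟩ with hσ
  set v := f fun _ => false with hv
  intro x
  -- Induction on the number of true bits. If `x` has true bits `i ≠ j`, and `y` is `x` with both
  -- cleared, then `f x` is a common neighbour of the known images of the two intermediate vertices.
  -- These have only two common neighbours, one of which is `f y`, so `f x` is the other.
  induction hc : (Finset.univ.filter fun i => x i = true).card using Nat.strong_induction_on
    generalizing x with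
  | _ c ih =>
  have hlt : ∀ (y : Fin ℓ → Bool) (i : Fin ℓ), y i = true →
      (Finset.univ.filter fun j => flipBit y i j = true).card <
        (Finset.univ.filter fun j => y j = true).card := by
    intro y i hi
    apply Finset.card_lt_card
    rw [Finset.ssubset_iff_of_subset]
    · exact ⟨i, by simpa using hi, by simp [flipBit_apply, hi]⟩
    · intro j
      simp only [Finset.mem_filter, Finset.mem_univ, true_and, flipBit_apply]
      by_cases h : i = j
      · subst h; simp [hi]
      · simp [h]
  by_cases h0 : ∃ i, x i = true
  · obtain ⟨i, hi⟩ := h0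
    by_cases h1 : ∃ j, j ≠ i ∧ x j = true
    · obtain ⟨j, hji, hj⟩ := h1
      set y := flipBit (flipBit x i) j with hy
      have hj' : flipBit x i j = true := by simp [flipBit_apply, hj, hji.symm]
      have e1 : f (flipBit x i) = subcubeMap v σ (flipBit x i) :=
        ih _ (hc ▸ hlt x i hi) _ rfl
      have e2 : f (flipBit x j) = subcubeMap v σ (flipBit x j) :=
        ih _ (hc ▸ hlt x j hj) _ rfl
      have e3 : f y = subcubeMap v σ y :=
        ih _ (hc ▸ (hlt _ j hj').trans (hlt x i hi)) _ rfl
      have q1 : flipBit x i = flipBit y j := by rw [hy, flipBit_flipBit_self]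
      have q2 : flipBit x j = flipBit y i := by
        rw [hy, flipBit_comm x i j, flipBit_flipBit_self]
      have q3 : x = flipBit (flipBit y j) i := by rw [← q1, flipBit_flipBit_self]
      clear_value y
      rw [q1, subcubeMap_flipBit] at e1
      rw [q2, subcubeMap_flipBit] at e2
      rw [← e3] at e1 e2
      obtain ⟨a, ha⟩ := hadj (flipBit y j) i
      obtain ⟨b, hb⟩ := hadj (flipBit y i) j
      rw [e1] at ha
      rw [e2, flipBit_comm y i j] at hb
      have hσij : σ j ≠ σ i := fun h => hji (σ.injective h)
      have hne : a ≠ σ j := by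
        rintro rfl
        rw [flipBit_flipBit_self] at ha
        exact flipBit_flipBit_ne y hji (hinj ha)
      rw [q3, subcubeMap_flipBit, subcubeMap_flipBit, ← e3, ha]
      rcases flipBit_flipBit_eq (f y) hne.symm (ha.symm.trans hb) with h | h
      · exact absurd h.1.symm hσij
      · rw [← h.1]
    · have hx0 : flipBit x i = fun _ => false := by
        funext j
        by_cases hij : i = j
        · subst hij; simp [flipBit_apply, hi]
        · have : x j = false := by
            by_contra h
            exact h1 ⟨j, fun e => hij e.symm, by simpa using h⟩
          simp [flipBit_apply, hij, this]
      have : x = flipBit (fun _ => false) i := by rw [← hx0, flipBit_flipBit_self]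
      rw [this, hs, subcubeMap_flipBit, subcubeMap_false]
      rfl
  · have : x = fun _ => false := by
      funext j
      by_contra h
      exact h0 ⟨j, by simpa using h⟩
    rw [this, subcubeMap_false]

theorem subcubeMap_adj {ℓ n : ℕ} (v : Fin n → Bool) (σ : Fin ℓ ↪ Fin n) {x y : Fin ℓ → Bool}
    (h : (hypercube ℓ).Adj x y) :
    ∃ i, subcubeMap v σ y = flipBit (subcubeMap v σ x) (σ i) := by
  obtain ⟨i, rfl⟩ := hypercube_adj_iff.1 h
  exact ⟨i, subcubeMap_flipBit v σ x i⟩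

theorem subcubeMap_inj {ℓ n : ℕ} {v w : Fin n → Bool} {σ τ : Fin ℓ ↪ Fin n}
    (h : subcubeMap v σ = subcubeMap w τ) : v = w ∧ σ = τ := by
  have hv : v = w := by
    rw [← subcubeMap_false v σ, h, subcubeMap_false]
  subst hv
  refine ⟨rfl, ?_⟩
  ext1 i
  have := congrFun h (flipBit (fun _ => false) i)
  rw [subcubeMap_flipBit, subcubeMap_flipBit, subcubeMap_false, subcubeMap_false] at this
  exact flipBit_injective v this

-- The base vertex and the injection of directions are free and determine the copy.
open SimpleGraph in
theorem card_copy_hypercube (ℓ n : ℕ) :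
    Nat.card (Copy (hypercube ℓ) (hypercube n)) = 2 ^ n * n.descFactorial ℓ := by
  let F : (Fin n → Bool) × (Fin ℓ ↪ Fin n) → Copy (hypercube ℓ) (hypercube n) := fun p =>
    ⟨⟨subcubeMap p.1 p.2, fun h => hypercube_adj_iff.2 <| by
      obtain ⟨i, hi⟩ := subcubeMap_adj p.1 p.2 h
      exact ⟨_, hi⟩⟩, subcubeMap_injective p.1 p.2⟩
  have hF : Function.Bijective F := by
    constructor
    · rintro ⟨v, σ⟩ ⟨w, τ⟩ h
      have : subcubeMap v σ = subcubeMap w τ :=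
        funext fun x => congrArg (fun f : Copy (hypercube ℓ) (hypercube n) => f x) h
      obtain ⟨rfl, rfl⟩ := subcubeMap_inj this
      rfl
    · intro f
      obtain ⟨σ, hσ⟩ := exists_eq_subcubeMap f
      exact ⟨(f fun _ => false, σ), Copy.ext fun x => (hσ x).symm⟩
  rw [← Nat.card_congr (Equiv.ofBijective F hF), Nat.card_prod]
  simp [Nat.card_eq_fintype_card, Fintype.card_embedding_eq]

/-! ### Cycles inside the hypercube -/

open SimpleGraph

/-- A subgraph contains a cycle as soon as its vertices can be listed in cyclic order. -/
theorem cycleGraph_isContained_of_seq {V : Type*} {G : SimpleGraph V} (G' : G.Subgraph) (N : ℕ)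
    (f : ℕ → V) (hinj : ∀ i < N, ∀ j < N, f i = f j → i = j)
    (hadj : ∀ i, i + 1 < N → G'.Adj (f i) (f (i + 1)))
    (hlast : G'.Adj (f (N - 1)) (f 0)) : cycleGraph N ⊑ G'.coe := by
  have hmem : ∀ i : Fin N, f i ∈ G'.verts := by
    intro i
    by_cases h : i.1 + 1 < N
    · exact (hadj i h).fst_mem
    · have : i.1 = N - 1 := by omega
      rw [this]
      exact hlast.fst_mem
  have key : ∀ u v : Fin N, (u - v).val = 1 → G'.Adj (f v) (f u) := by
    intro u v h
    rw [Fin.sub_def] at h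
    have hu := u.2
    have hv := v.2
    simp only at h
    -- Subtraction in `Fin N` wraps around: a difference of 1 is either the closing edge or a step
    -- `v + 1 = u`.
    rcases Nat.lt_or_ge (N - v.1 + u.1) N with h1 | h1
    · rw [Nat.mod_eq_of_lt h1] at h
      have e1 : v.1 = N - 1 := by omega
      have e2 : u.1 = 0 := by omega
      rw [e1, e2]
      exact hlast
    · rw [Nat.mod_eq_sub_mod h1, Nat.mod_eq_of_lt (by omega)] at h
      have e1 : u.1 = v.1 + 1 := by omega
      rw [e1]
      exact hadj v (by omega)
  refine ⟨⟨⟨fun i => ⟨f i, hmem i⟩, ?_⟩, ?_⟩⟩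
  · intro u v h
    rcases cycleGraph_adj'.1 h with h | h
    · exact (key u v h).symm
    · exact key v u h
  · intro i j h
    exact Fin.ext (hinj i i.2 j j.2 (congrArg Subtype.val h))

theorem hypercube_cons_adj {m : ℕ} {u v : Fin m → Bool} (b : Bool) (h : (hypercube m).Adj u v) :
    (hypercube (m + 1)).Adj (Fin.cons b u : Fin (m + 1) → Bool) (Fin.cons b v) := by
  obtain ⟨i, rfl⟩ := hypercube_adj_iff.1 h
  refine hypercube_adj_iff.2 ⟨i.succ, ?_⟩
  funext j
  refine Fin.cases ?_ (fun j => ?_) j <;> simp [flipBit_apply]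

theorem hypercube_cons_adj_cons {m : ℕ} (u : Fin m → Bool) :
    (hypercube (m + 1)).Adj (Fin.cons false u : Fin (m + 1) → Bool) (Fin.cons true u) := by
  refine hypercube_adj_iff.2 ⟨0, ?_⟩
  funext j
  refine Fin.cases ?_ (fun j => ?_) j
  · simp [flipBit_apply]
  · simp [flipBit_apply, (Fin.succ_ne_zero j).symm]

/-- The hypercube has a Hamiltonian path. -/
theorem exists_hamiltonian_path_hypercube (m : ℕ) : ∃ p : ℕ → Fin m → Bool,
    (∀ i < 2 ^ m, ∀ j < 2 ^ m, p i = p j → i = j) ∧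
      ∀ i, i + 1 < 2 ^ m → (hypercube m).Adj (p i) (p (i + 1)) := by
  induction m with
  | zero => exact ⟨fun _ => Fin.elim0, by simp, by simp⟩
  | succ m ih =>
    obtain ⟨p, hp, hadj⟩ := ih
    have hpow : 2 ^ (m + 1) = 2 * 2 ^ m := by ring
    have hpos : 0 < 2 ^ m := by positivity
    rw [hpow]
    generalize 2 ^ m = N at *
    -- Reflected Gray code: traverse the lower face, cross over, and return through the upper face.
    refine ⟨fun i => if i < N then Fin.cons false (p i) else Fin.cons true (p (2 * N - 1 - i)),
      ?_, ?_⟩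
    · intro i hi j hj h
      dsimp only at h
      split_ifs at h with h1 h2 h2
      · exact hp i h1 j h2 (Fin.cons_right_injective (α := fun _ => Bool) _ h)
      · exact absurd (congrFun h 0) (by simp)
      · exact absurd (congrFun h 0) (by simp)
      · have := hp _ (by omega) _ (by omega) (Fin.cons_right_injective (α := fun _ => Bool) _ h)
        omega
    · intro i hi
      dsimp only
      split_ifs with h1 h2 h2
      · exact hypercube_cons_adj _ (hadj i h2)
      · have : 2 * N - 1 - (i + 1) = i := by omega
        rw [this]
        exact hypercube_cons_adj_cons _
      · omega
      · have := hadj (2 * N - 1 - (i + 1)) (by omega)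
        rw [show 2 * N - 1 - (i + 1) + 1 = 2 * N - 1 - i by omega] at this
        exact hypercube_cons_adj _ this.symm

/-- The first `k` vertices of a Hamiltonian path of `Q_{ℓ-1}`, walked forward in one face and
backward in the opposite one, close up to a cycle of length `2k`. -/
theorem cycleGraph_isContained_hypercube {k ℓ : ℕ} (hk : 1 ≤ k) (h : 2 * k ≤ 2 ^ ℓ) :
    cycleGraph (2 * k) ⊑ hypercube ℓ := by
  obtain _ | m := ℓ
  · simp at h; omega
  obtain ⟨p, hp, hadj⟩ := exists_hamiltonian_path_hypercube m
  have hpow : 2 ^ (m + 1) = 2 * 2 ^ m := by ring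
  have hkm : k ≤ 2 ^ m := by omega
  refine (cycleGraph_isContained_of_seq (⊤ : (hypercube (m + 1)).Subgraph) (2 * k)
    (fun i => if i < k then Fin.cons false (p i) else Fin.cons true (p (2 * k - 1 - i)))
    ?_ ?_ ?_).trans (Subgraph.coe_isContained _)
  · intro i hi j hj h
    split_ifs at h with h1 h2 h2
    · exact hp i (by omega) j (by omega) (Fin.cons_right_injective (α := fun _ => Bool) _ h)
    · exact absurd (congrFun h 0) (by simp)
    · exact absurd (congrFun h 0) (by simp)
    · have := hp _ (by omega) _ (by omega) (Fin.cons_right_injective (α := fun _ => Bool) _ h)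
      omega
  · intro i hi
    rw [Subgraph.top_adj]
    split_ifs with h1 h2 h2
    · exact hypercube_cons_adj _ (hadj i (by omega))
    · have : 2 * k - 1 - (i + 1) = i := by omega
      rw [this]
      exact hypercube_cons_adj_cons _
    · omega
    · have := hadj (2 * k - 1 - (i + 1)) (by omega)
      rw [show 2 * k - 1 - (i + 1) + 1 = 2 * k - 1 - i by omega] at this
      exact hypercube_cons_adj _ this.symm
  · rw [Subgraph.top_adj]
    rw [if_neg (by omega), if_pos (by omega), show 2 * k - 1 - (2 * k - 1) = 0 by omega]
    exact (hypercube_cons_adj_cons _).symm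

/-! ### Upper bound: paths of squares -/

/-- A graph with many adjacent pairs contains a path on `k` vertices. -/
theorem exists_path_of_card_adj {α : Type*} [DecidableEq α] (H : SimpleGraph α)
    [DecidableRel H.Adj] (k : ℕ) (S : Finset α)
    (hS : 2 * k * S.card < ((S ×ˢ S).filter fun p => H.Adj p.1 p.2).card) :
    ∃ l : List α, l.length = k ∧ l.Nodup ∧ l.IsChain H.Adj := by
  induction S using Finset.strongInduction with
  | H S ih =>
  by_cases hdeg : ∀ a ∈ S, k ≤ (S.filter fun b => H.Adj a b).card
  · have hne : S.Nonempty := by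
      rw [Finset.nonempty_iff_ne_empty]
      rintro rfl
      simp at hS
    -- Minimum degree at least `k` lets a path on fewer than `k` vertices be extended greedily at
    -- its head.
    have : ∀ r ≤ k, ∃ l : List α, l.length = r ∧ l.Nodup ∧ l.IsChain H.Adj ∧ ∀ a ∈ l, a ∈ S := by
      intro r
      induction r with
      | zero => exact fun _ => ⟨[], by simp⟩
      | succ r ihr =>
        intro hr
        obtain ⟨l, hl, hnd, hch, hlS⟩ := ihr (by omega)
        cases l with
        | nil =>
          obtain ⟨a, ha⟩ := hne
          exact ⟨[a], by simpa [eq_comm] using hl, by simp, by simp, by simpa using ha⟩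
        | cons a t =>
          have hlt : t.toFinset.card < (S.filter fun b => H.Adj a b).card := by
            have h1 := t.toFinset_card_le
            have h2 := hdeg a (hlS a (by simp))
            simp only [List.length_cons] at hl
            omega
          obtain ⟨b, hb, hbt⟩ := Finset.exists_mem_notMem_of_card_lt_card hlt
          simp only [Finset.mem_filter] at hb
          refine ⟨b :: a :: t, by simpa using hl, ?_, ?_, ?_⟩
          · rw [List.nodup_cons]
            refine ⟨?_, hnd⟩
            simp only [List.mem_cons, not_or]
            exact ⟨hb.2.ne', by simpa using hbt⟩
          · rw [List.isChain_cons_cons]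
            exact ⟨hb.2.symm, hch⟩
          · intro c hc
            rcases List.mem_cons.1 hc with rfl | hc
            · exact hb.1
            · exact hlS c hc
    obtain ⟨l, h1, h2, h3, -⟩ := this k le_rfl
    exact ⟨l, h1, h2, h3⟩
  · push Not at hdeg
    obtain ⟨a, ha, hlt⟩ := hdeg
    -- Deleting a vertex of degree below `k` loses fewer than `2k` ordered pairs, so the density
    -- hypothesis survives.
    apply ih (S.erase a) (Finset.erase_ssubset ha)
    have hcard : (S.erase a).card + 1 = S.card := Finset.card_erase_add_one ha
    have hsub : ((S ×ˢ S).filter fun p => H.Adj p.1 p.2) ⊆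
        (((S.erase a ×ˢ S.erase a).filter fun p => H.Adj p.1 p.2) ∪
          (S.filter fun b => H.Adj a b).image fun b => (a, b)) ∪
            (S.filter fun b => H.Adj a b).image fun b => (b, a) := by
      rintro ⟨x, y⟩ hxy
      simp only [Finset.mem_filter, Finset.mem_product] at hxy
      simp only [Finset.mem_union, Finset.mem_filter, Finset.mem_product, Finset.mem_erase,
        Finset.mem_image, Prod.mk.injEq]
      by_cases hx : x = a
      · subst hx
        exact Or.inl (Or.inr ⟨y, ⟨hxy.1.2, hxy.2⟩, rfl, rfl⟩)
      · by_cases hy : y = a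
        · subst hy
          exact Or.inr ⟨x, ⟨hxy.1.1, hxy.2.symm⟩, rfl, rfl⟩
        · exact Or.inl (Or.inl ⟨⟨⟨hx, hxy.1.1⟩, hy, hxy.1.2⟩, hxy.2⟩)
    have h1 := Finset.card_le_card hsub
    have h2 := Finset.card_union_le
      (((S.erase a ×ˢ S.erase a).filter fun p => H.Adj p.1 p.2) ∪
          (S.filter fun b => H.Adj a b).image fun b => (a, b))
      ((S.filter fun b => H.Adj a b).image fun b => (b, a))
    have h3 := Finset.card_union_le
      ((S.erase a ×ˢ S.erase a).filter fun p => H.Adj p.1 p.2)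
      ((S.filter fun b => H.Adj a b).image fun b => (a, b))
    have h4 := Finset.card_image_le (s := S.filter fun b => H.Adj a b) (f := fun b => (a, b))
    have h5 := Finset.card_image_le (s := S.filter fun b => H.Adj a b) (f := fun b => (b, a))
    rw [← hcard] at hS
    rw [mul_add] at hS
    omega


/-- The graph on the coordinates in which `i` and `j` are adjacent when the whole square at `v` in
the directions `i` and `j` lies in `G'`. -/
def squareGraph {n : ℕ} (G' : (hypercube n).Subgraph) (v : Fin n → Bool) :
    SimpleGraph (Fin n) where
  Adj i j := i ≠ j ∧ G'.Adj v (flipBit v i) ∧ G'.Adj v (flipBit v j) ∧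
    G'.Adj (flipBit v i) (flipBit (flipBit v i) j) ∧
    G'.Adj (flipBit v j) (flipBit (flipBit v i) j)
  symm := ⟨fun i j ⟨h1, h2, h3, h4, h5⟩ =>
    ⟨h1.symm, h3, h2, by rwa [flipBit_comm], by rwa [flipBit_comm]⟩⟩
  loopless := ⟨fun _ h => h.1 rfl⟩

/-- A path on `k` vertices in the square graph at `v` gives a cycle of length `2 * k`. -/
theorem cycleGraph_isContained_of_path {n k : ℕ} (hk : 2 ≤ k) (G' : (hypercube n).Subgraph)
    (v : Fin n → Bool) (l : List (Fin n)) (hl : l.length = k) (hnd : l.Nodup)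
    (hch : l.IsChain (squareGraph G' v).Adj) : cycleGraph (2 * k) ⊑ G'.coe := by
  have hpos : 0 < l.length := by omega
  let p : ℕ → Fin n := fun i => l.getD i l[0]
  have hp : ∀ i (h : i < l.length), p i = l[i] := fun i h => List.getD_eq_getElem _ _ h
  have hpinj : ∀ i < k, ∀ j < k, p i = p j → i = j := by
    intro i hi j hj h
    rw [hp i (by omega), hp j (by omega)] at h
    exact (hnd.getElem_inj_iff).1 h
  have hadj : ∀ i, i + 1 < k → (squareGraph G' v).Adj (p i) (p (i + 1)) := by
    intro i hi
    rw [hp i (by omega), hp (i + 1) (by omega)]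
    exact List.isChain_iff_getElem.1 hch i (by omega)
  clear_value p
  have hsq : ∀ j i, j + 1 < k → i + 1 < k →
      flipBit (flipBit v (p j)) (p (j + 1)) = flipBit (flipBit v (p i)) (p (i + 1)) → j = i := by
    intro j i hj hi h
    rcases flipBit_flipBit_eq v (hadj j hj).1 h with h | h
    · exact (hpinj _ (by omega) _ (by omega) h.1).symm
    · have h1 := hpinj _ (by omega) _ (by omega) h.1
      have h2 := hpinj _ (by omega) _ (by omega) h.2
      omega
  -- The cycle is `v, v+p₀, v+p₀+p₁, v+p₁, v+p₁+p₂, …, v+p₍ₖ₋₁₎`: one base vertex, `k` single flips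
  -- and `k - 1` double flips.
  let f : ℕ → Fin n → Bool := fun i =>
    if i = 0 then v
    else if i % 2 = 1 then flipBit v (p (i / 2))
    else flipBit (flipBit v (p (i / 2 - 1))) (p (i / 2))
  have f0 : f 0 = v := rfl
  have fodd : ∀ j, f (2 * j + 1) = flipBit v (p j) := by
    intro j
    simp only [f]
    rw [if_neg (by omega), if_pos (by omega)]
    congr 2
    omega
  have feven : ∀ j, f (2 * j + 2) = flipBit (flipBit v (p j)) (p (j + 1)) := by
    intro j
    simp only [f]
    rw [if_neg (by omega), if_neg (by omega), show (2 * j + 2) / 2 = j + 1 by omega,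
      Nat.add_sub_cancel]
  have hcases : ∀ i, i = 0 ∨ (∃ j, i = 2 * j + 1) ∨ ∃ j, i = 2 * j + 2 := by
    intro i
    rcases Nat.even_or_odd' i with ⟨j, h | h⟩
    · rcases Nat.eq_zero_or_pos j with h' | h'
      · left; omega
      · right; right; exact ⟨j - 1, by omega⟩
    · right; left; exact ⟨j, h⟩
  apply cycleGraph_isContained_of_seq G' (2 * k) f
  · intro i hi j hj h
    rcases hcases i with rfl | ⟨a, rfl⟩ | ⟨a, rfl⟩ <;> rcases hcases j with rfl | ⟨b, rfl⟩ | ⟨b, rfl⟩ <;>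
      simp only [f0, fodd, feven] at h
    · rfl
    · exact absurd h.symm (flipBit_ne _ _)
    · exact absurd h.symm (flipBit_flipBit_ne _ (hadj b (by omega)).1)
    · exact absurd h (flipBit_ne _ _)
    · rw [hpinj a (by omega) b (by omega) (flipBit_injective v h)]
    · exact absurd h.symm (flipBit_flipBit_ne_flipBit _ _ _ _)
    · exact absurd h (flipBit_flipBit_ne _ (hadj a (by omega)).1)
    · exact absurd h (flipBit_flipBit_ne_flipBit _ _ _ _)
    · rw [hsq a b (by omega) (by omega) h]
  · intro i hi
    rcases hcases i with rfl | ⟨a, rfl⟩ | ⟨a, rfl⟩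
    · rw [f0, show 0 + 1 = 2 * 0 + 1 from rfl, fodd]
      exact (hadj 0 (by omega)).2.1
    · rw [fodd, show 2 * a + 1 + 1 = 2 * a + 2 from rfl, feven]
      exact (hadj a (by omega)).2.2.2.1
    · rw [feven, show 2 * a + 2 + 1 = 2 * (a + 1) + 1 by ring, fodd]
      exact (hadj a (by omega)).2.2.2.2.symm
  · obtain ⟨j, rfl⟩ : ∃ j, k = j + 2 := ⟨k - 2, by omega⟩
    rw [show 2 * (j + 2) - 1 = 2 * (j + 1) + 1 by omega, fodd, f0]
    exact (hadj j (by omega)).2.2.1.symm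

/-- A `C_{2k}`-free subgraph of the hypercube contains few labelled copies of `Q_{ℓ+2}`. -/
theorem card_copy_le_of_free {n k : ℕ} (hk : 2 ≤ k) (ℓ : ℕ) (G' : (hypercube n).Subgraph)
    (hfree : (cycleGraph (2 * k)).Free G'.coe) :
    Nat.card (Copy (hypercube (ℓ + 2)) G'.coe) ≤ 2 ^ n * (2 * k * n) * n ^ ℓ := by
  classical
  have hpairs : ∀ v, Fintype.card {p : Fin n × Fin n // (squareGraph G' v).Adj p.1 p.2} ≤
      2 * k * n := by
    intro v
    by_contra! h
    rw [Fintype.card_subtype] at h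
    have h' : 2 * k * (Finset.univ : Finset (Fin n)).card <
        ((Finset.univ ×ˢ Finset.univ).filter fun p : Fin n × Fin n =>
          (squareGraph G' v).Adj p.1 p.2).card := by
      simpa using h
    obtain ⟨l, h1, h2, h3⟩ := exists_path_of_card_adj (squareGraph G' v) k Finset.univ h'
    exact hfree (cycleGraph_isContained_of_path hk G' v l h1 h2 h3)
  have hrep : ∀ f : Copy (hypercube (ℓ + 2)) G'.coe, ∃ (v : Fin n → Bool) (σ : Fin (ℓ + 2) ↪ Fin n),
      (∀ x, (f x : Fin n → Bool) = subcubeMap v σ x) ∧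
        (squareGraph G' v).Adj (σ 0) (σ 1) := by
    intro f
    obtain ⟨σ, hσ⟩ := exists_eq_subcubeMap (G'.coeCopy.comp f)
    set v := (G'.coeCopy.comp f) fun _ => false
    have hσ' : ∀ x, (f x : Fin n → Bool) = subcubeMap v σ x := hσ
    have hadj : ∀ x i, G'.Adj (subcubeMap v σ x) (subcubeMap v σ (flipBit x i)) := by
      intro x i
      rw [← hσ', ← hσ']
      exact f.toHom.map_adj (hypercube_adj_flipBit x i)
    refine ⟨v, σ, hσ', fun h => by simpa using σ.injective h, ?_, ?_, ?_, ?_⟩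
    · simpa [subcubeMap_flipBit, subcubeMap_false] using hadj (fun _ => false) 0
    · simpa [subcubeMap_flipBit, subcubeMap_false] using hadj (fun _ => false) 1
    · simpa [subcubeMap_flipBit, subcubeMap_false] using hadj (flipBit (fun _ => false) 0) 1
    · rw [flipBit_comm]
      simpa [subcubeMap_flipBit, subcubeMap_false] using hadj (flipBit (fun _ => false) 1) 0
  choose v σ hσ hsq using hrep
  -- Only the first two directions are constrained, as an edge of the square graph at `v`;
  -- injectivity of the rest is forgotten.
  let F : Copy (hypercube (ℓ + 2)) G'.coe →
      (Σ v : Fin n → Bool, {p : Fin n × Fin n // (squareGraph G' v).Adj p.1 p.2}) ×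
        (Fin ℓ → Fin n) :=
    fun f => (⟨v f, ⟨(σ f 0, σ f 1), hsq f⟩⟩, fun i => σ f i.succ.succ)
  have hF : Function.Injective F := by
    intro f g h
    have h1 : v f = v g := congrArg (fun x => x.1.1) h
    have h2 : σ f 0 = σ g 0 := congrArg (fun x => x.1.2.1.1) h
    have h3 : σ f 1 = σ g 1 := congrArg (fun x => x.1.2.1.2) h
    have h4 : ∀ i : Fin ℓ, σ f i.succ.succ = σ g i.succ.succ :=
      fun i => congrArg (fun x => x.2 i) h
    have h5 : σ f = σ g := by
      ext1 i
      refine Fin.cases h2 (fun i => ?_) i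
      refine Fin.cases h3 (fun i => h4 i) i
    apply Copy.ext
    intro x
    apply Subtype.ext
    rw [hσ, hσ, h1, h5]
  calc Nat.card (Copy (hypercube (ℓ + 2)) G'.coe) ≤ Nat.card
        ((Σ v : Fin n → Bool, {p : Fin n × Fin n // (squareGraph G' v).Adj p.1 p.2}) ×
        (Fin ℓ → Fin n)) := Nat.card_le_card_of_injective F hF
    _ = (∑ v, Fintype.card {p : Fin n × Fin n // (squareGraph G' v).Adj p.1 p.2}) * n ^ ℓ := by
      rw [Nat.card_prod, Nat.card_eq_fintype_card, Fintype.card_sigma]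
      simp
    _ ≤ (∑ _v : Fin n → Bool, 2 * k * n) * n ^ ℓ := by
      gcongr with v
      exact hpairs v
    _ = 2 ^ n * (2 * k * n) * n ^ ℓ := by simp

/-! ### Lower bound: disjoint small cubes -/

/-- The spanning subgraph of the hypercube of the edges in one of the first `m` directions. -/
def lowSubgraph (m n : ℕ) : (hypercube n).Subgraph where
  verts := Set.univ
  Adj u v := (hypercube n).Adj u v ∧ ∀ i : Fin n, m ≤ i.1 → u i = v i
  adj_sub h := h.1
  edge_vert _ := trivial
  symm := ⟨fun _ _ h => ⟨h.1.symm, fun i hi => (h.2 i hi).symm⟩⟩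

/-- Coordinates from `m` on are constant on a connected subgraph, so a cycle would embed its `N`
vertices into the `2 ^ m` values of the first `m` coordinates. -/
theorem lowSubgraph_free {m n N : ℕ} (hmn : m ≤ n) (hN : 2 ^ m < N) :
    (cycleGraph N).Free (lowSubgraph m n).coe := by
  rintro ⟨f⟩
  have hinv : ∀ a b : Fin N, (cycleGraph N).Reachable a b →
      ∀ i : Fin n, m ≤ i.1 → (f a).1 i = (f b).1 i := by
    rintro a b ⟨w⟩ i hi
    induction w with
    | nil => rfl
    | cons h _ ih => exact ((f.toHom.map_adj h).2 i hi).trans ih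
  have hg : Function.Injective fun (a : Fin N) (i : Fin m) => (f a).1 (Fin.castLE hmn i) := by
    intro a b h
    apply f.injective
    apply Subtype.ext
    funext i
    by_cases hi : i.1 < m
    · exact congrFun h ⟨i, hi⟩
    · exact hinv a b (cycleGraph_preconnected a b) i (by omega)
  have := Fintype.card_le_of_injective _ hg
  simp at this
  omega

theorem le_card_copy_lowSubgraph (ℓ : ℕ) {m n : ℕ} (hmn : m ≤ n) :
    2 ^ n * m.descFactorial ℓ ≤ Nat.card (Copy (hypercube ℓ) (lowSubgraph m n).coe) := by
  let F : (Fin n → Bool) × (Fin ℓ ↪ Fin m) → Copy (hypercube ℓ) (lowSubgraph m n).coe := fun p =>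
    ⟨⟨fun x => ⟨subcubeMap p.1 (p.2.trans (Fin.castLEEmb hmn)) x, trivial⟩, fun h => by
      obtain ⟨i, hi⟩ := subcubeMap_adj p.1 (p.2.trans (Fin.castLEEmb hmn)) h
      refine ⟨hypercube_adj_iff.2 ⟨_, hi⟩, fun j hj => ?_⟩
      change _ = subcubeMap p.1 (p.2.trans (Fin.castLEEmb hmn)) _ j
      rw [hi, flipBit_apply]
      have : ¬ (p.2.trans (Fin.castLEEmb hmn)) i = j := by
        rintro rfl
        have := (p.2 i).2
        simp at hj
        omega
      rw [decide_eq_false this, Bool.xor_false]⟩, fun x y h => subcubeMap_injective _ _ (congrArg Subtype.val h)⟩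
  have hF : Function.Injective F := by
    rintro ⟨v, σ⟩ ⟨w, τ⟩ h
    have : subcubeMap v (σ.trans (Fin.castLEEmb hmn)) = subcubeMap w (τ.trans (Fin.castLEEmb hmn)) :=
      funext fun x => congrArg
        (fun f : Copy (hypercube ℓ) (lowSubgraph m n).coe => (f x).1) h
    obtain ⟨rfl, h'⟩ := subcubeMap_inj this
    have : σ = τ := by
      ext1 i
      exact (Fin.castLEEmb hmn).injective (DFunLike.congr_fun h' i)
    rw [this]
  have : Finite (Copy (hypercube ℓ) (lowSubgraph m n).coe) :=
    Finite.of_injective _ DFunLike.coe_injective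
  have := Nat.card_le_card_of_injective F hF
  rw [Nat.card_prod] at this
  simpa [Nat.card_eq_fintype_card, Fintype.card_embedding_eq] using this


/-! ### From counts to densities -/

open Classical in
theorem copyCount_le_genExtremalNumber {V W U : Type*} [Fintype V] {G : SimpleGraph V}
    (T : SimpleGraph W) {H : SimpleGraph U} {G' : G.Subgraph} (h : H.Free G'.coe) :
    G'.coe.copyCount T ≤ genExtremalNumber G T H := by
  unfold genExtremalNumber
  exact Finset.le_sup (f := fun G' : G.Subgraph => G'.coe.copyCount T)
    (Finset.mem_filter.2 ⟨Finset.mem_univ G', h⟩)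

-- The factor `a` will be the automorphism number, so that bounds on labelled copies apply directly.
open Classical in
theorem genExtremalNumber_mul_le {V W U : Type*} [Fintype V] {G : SimpleGraph V}
    {T : SimpleGraph W} {H : SimpleGraph U} {a b : ℕ}
    (h : ∀ G' : G.Subgraph, H.Free G'.coe → G'.coe.copyCount T * a ≤ b) :
    genExtremalNumber G T H * a ≤ b := by
  unfold genExtremalNumber
  refine Finset.sup_induction (p := fun c => c * a ≤ b) (by simp) ?_ ?_
  · intro x hx y hy
    rcases max_choice x y with e | e <;> simp only [e, hx, hy]
  · intro G' hG'
    exact h G' (Finset.mem_filter.1 hG').2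

/-- Each of the `ℓ` factors of the falling factorial is at least `n + 1 - ℓ ≥ n / ℓ`. -/
theorem pow_le_pow_self_mul_descFactorial {ℓ n : ℕ} (h1 : 1 ≤ ℓ) (h : ℓ ≤ n) :
    n ^ ℓ ≤ ℓ ^ ℓ * n.descFactorial ℓ := by
  have h2 : n ≤ ℓ * (n + 1 - ℓ) := by
    obtain ⟨d, rfl⟩ := Nat.exists_eq_add_of_le h
    rw [show ℓ + d + 1 - ℓ = d + 1 by omega]
    nlinarith
  calc n ^ ℓ ≤ (ℓ * (n + 1 - ℓ)) ^ ℓ := Nat.pow_le_pow_left h2 ℓ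
    _ = ℓ ^ ℓ * (n + 1 - ℓ) ^ ℓ := mul_pow _ _ _
    _ ≤ ℓ ^ ℓ * n.descFactorial ℓ := Nat.mul_le_mul_left _ (Nat.pow_sub_le_descFactorial n ℓ)

theorem logb_two_le_natCast_iff {k n : ℕ} (hk : 1 ≤ k) :
    Real.logb 2 (2 * (k : ℝ)) ≤ (n : ℝ) ↔ 2 * k ≤ 2 ^ n := by
  have : (0 : ℝ) < 2 * k := by positivity
  rw [Real.logb_le_iff_le_rpow one_lt_two this, Real.rpow_natCast]
  exact_mod_cast Iff.rfl

theorem genTuranDensity_hypercube_eq_zero {k ℓ : ℕ} (n : ℕ) (hk : 1 ≤ k) (h : 2 * k ≤ 2 ^ ℓ) :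
    genTuranDensity (hypercube n) (hypercube ℓ) (cycleGraph (2 * k)) = 0 := by
  classical
  have : genExtremalNumber (hypercube n) (hypercube ℓ) (cycleGraph (2 * k)) * 1 ≤ 0 :=
    genExtremalNumber_mul_le fun G' hG' => by
      rw [mul_one, Nat.le_zero, copyCount_eq_zero]
      exact fun hQ => hG' ((cycleGraph_isContained_hypercube hk h).trans hQ)
  have h0 : genExtremalNumber (hypercube n) (hypercube ℓ) (cycleGraph (2 * k)) = 0 := by omega
  simp [genTuranDensity, h0]

theorem card_automorphism_pos {V : Type*} [Finite V] (G : SimpleGraph V) :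
    0 < Nat.card (G ≃g G) := by
  have : Finite (G ≃g G) := Finite.of_injective _ DFunLike.coe_injective
  have : Nonempty (G ≃g G) := ⟨Iso.refl⟩
  exact Nat.card_pos

theorem le_genTuranDensity_hypercube {ℓ m n N : ℕ} (hℓ : ℓ ≤ n) (hmn : m ≤ n) (hN : 2 ^ m < N) :
    (m.choose ℓ : ℝ) * ((n.choose ℓ : ℝ))⁻¹ ≤
      genTuranDensity (hypercube n) (hypercube ℓ) (cycleGraph N) := by
  classical
  set A := Nat.card (hypercube ℓ ≃g hypercube ℓ) with hA
  have hApos : 0 < A := card_automorphism_pos _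
  have hcard := card_copy_hypercube ℓ n
  rw [card_copy_eq_copyCount_mul, ← hA] at hcard
  have hlow := le_card_copy_lowSubgraph ℓ hmn
  rw [card_copy_eq_copyCount_mul, ← hA] at hlow
  have hex := copyCount_le_genExtremalNumber (hypercube ℓ) (lowSubgraph_free hmn hN)
  have hex' : 2 ^ n * m.descFactorial ℓ ≤
      genExtremalNumber (hypercube n) (hypercube ℓ) (cycleGraph N) * A :=
    hlow.trans (Nat.mul_le_mul_right A hex)
  unfold genTuranDensity
  generalize genExtremalNumber (hypercube n) (hypercube ℓ) (cycleGraph N) = e at *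
  have hnpos : 0 < n.choose ℓ := Nat.choose_pos hℓ
  have hdpos : 0 < n.descFactorial ℓ := Nat.descFactorial_pos.2 hℓ
  have hCpos : 0 < (hypercube n).copyCount (hypercube ℓ) := by
    refine Nat.pos_of_mul_pos_right (b := A) ?_
    rw [hcard]
    positivity
  generalize (hypercube n).copyCount (hypercube ℓ) = C at *
  rw [← div_eq_mul_inv, div_le_div_iff₀ (by exact_mod_cast hnpos) (by exact_mod_cast hCpos)]
  norm_cast
  rw [Nat.descFactorial_eq_factorial_mul_choose] at hcard hex'
  have hfpos : 0 < ℓ.factorial := ℓ.factorial_pos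
  -- The factor `A * ℓ.factorial` turns both sides into labelled counts and falling factorials,
  -- avoiding division.
  refine Nat.le_of_mul_le_mul_right ?_ (Nat.mul_pos hApos hfpos)
  calc m.choose ℓ * C * (A * ℓ.factorial) = m.choose ℓ * (C * A) * ℓ.factorial := by ring
    _ = (2 ^ n * (ℓ.factorial * m.choose ℓ)) * (ℓ.factorial * n.choose ℓ) := by rw [hcard]; ring
    _ ≤ (e * A) * (ℓ.factorial * n.choose ℓ) := Nat.mul_le_mul_right _ hex'
    _ = e * n.choose ℓ * (A * ℓ.factorial) := by ring

theorem genTuranDensity_hypercube_le {k ℓ n : ℕ} (hk : 2 ≤ k) (h2 : 2 ≤ ℓ) (hℓ : ℓ ≤ n) :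
    genTuranDensity (hypercube n) (hypercube ℓ) (cycleGraph (2 * k)) ≤
      2 * k * (ℓ : ℝ) ^ ℓ * (n : ℝ)⁻¹ := by
  classical
  obtain ⟨l, rfl⟩ : ∃ l, ℓ = l + 2 := ⟨ℓ - 2, by omega⟩
  set A := Nat.card (hypercube (l + 2) ≃g hypercube (l + 2)) with hA
  have hApos : 0 < A := card_automorphism_pos _
  have hcard := card_copy_hypercube (l + 2) n
  rw [card_copy_eq_copyCount_mul, ← hA] at hcard
  have hex : genExtremalNumber (hypercube n) (hypercube (l + 2)) (cycleGraph (2 * k)) * A ≤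
      2 ^ n * (2 * k * n) * n ^ l :=
    genExtremalNumber_mul_le fun G' hG' => by
      have := card_copy_le_of_free hk l G' hG'
      rwa [card_copy_eq_copyCount_mul] at this
  have hpow := pow_le_pow_self_mul_descFactorial (by omega) hℓ
  unfold genTuranDensity
  generalize genExtremalNumber (hypercube n) (hypercube (l + 2)) (cycleGraph (2 * k)) = e at *
  have hdpos : 0 < n.descFactorial (l + 2) := Nat.descFactorial_pos.2 hℓ
  have hCpos : 0 < (hypercube n).copyCount (hypercube (l + 2)) := by
    refine Nat.pos_of_mul_pos_right (b := A) ?_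
    rw [hcard]
    positivity
  generalize (hypercube n).copyCount (hypercube (l + 2)) = C at *
  have hn : 0 < n := by omega
  rw [← div_eq_mul_inv, div_le_div_iff₀ (by exact_mod_cast hCpos) (by exact_mod_cast hn)]
  norm_cast
  refine Nat.le_of_mul_le_mul_right ?_ hApos
  calc e * n * A = e * A * n := by ring
    _ ≤ 2 ^ n * (2 * k * n) * n ^ l * n := Nat.mul_le_mul_right _ hex
    _ = 2 ^ n * (2 * k) * n ^ (l + 2) := by ring
    _ ≤ 2 ^ n * (2 * k) * ((l + 2) ^ (l + 2) * n.descFactorial (l + 2)) :=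
      Nat.mul_le_mul_left _ hpow
    _ = 2 * k * (l + 2) ^ (l + 2) * (2 ^ n * n.descFactorial (l + 2)) := by ring
    _ = 2 * k * (l + 2) ^ (l + 2) * C * A := by rw [← hcard]; ring

theorem theorem4 :
    (∀ k ℓ n : ℕ, 2 ≤ k → Real.logb 2 (2 * (k : ℝ)) ≤ (ℓ : ℝ) →
      genTuranDensity (hypercube n) (hypercube ℓ) (SimpleGraph.cycleGraph (2 * k)) = 0) ∧
    (∀ k : ℕ, 4 ≤ k → k ≠ 5 → ∃ c : ℝ, 0 < c ∧
      ∀ ℓ n m : ℕ, 2 ≤ ℓ → (ℓ : ℝ) < Real.logb 2 (2 * (k : ℝ)) →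
        Real.logb 2 (2 * (k : ℝ)) ≤ (n : ℝ) →
        (m : ℤ) = ⌈Real.logb 2 (2 * (k : ℝ))⌉ - 1 →
        (m.choose ℓ : ℝ) * ((n.choose ℓ : ℝ))⁻¹ ≤
            genTuranDensity (hypercube n) (hypercube ℓ) (SimpleGraph.cycleGraph (2 * k)) ∧
          genTuranDensity (hypercube n) (hypercube ℓ) (SimpleGraph.cycleGraph (2 * k)) ≤
            c * (n : ℝ) ^ (-(1 / 16 : ℝ))) := by
  refine ⟨fun k ℓ n hk h => genTuranDensity_hypercube_eq_zero n (by omega)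
    ((logb_two_le_natCast_iff (by omega)).1 h), fun k hk _ => ?_⟩
  -- Since `ℓ < 2 ^ ℓ < 2 * k`, the factor `ℓ ^ ℓ` is at most `(2 * k) ^ (2 * k)`, which removes the
  -- dependence on `ℓ`.
  refine ⟨2 * k * (2 * k : ℝ) ^ (2 * k), by positivity, fun ℓ n m hℓ hℓk hkn hm => ?_⟩
  have hk1 : 1 ≤ k := by omega
  have hℓn : ℓ < n := by exact_mod_cast hℓk.trans_le hkn
  have hmL : (m : ℝ) < Real.logb 2 (2 * (k : ℝ)) := by
    have : (m : ℤ) < ⌈Real.logb 2 (2 * (k : ℝ))⌉ := by omega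
    exact_mod_cast Int.lt_ceil.1 this
  have hmn : m < n := by exact_mod_cast hmL.trans_le hkn
  have h2m : 2 ^ m < 2 * k := by
    rw [← not_le] at hmL ⊢
    exact fun h => hmL ((logb_two_le_natCast_iff hk1).2 h)
  have h2ℓ : 2 ^ ℓ < 2 * k := by
    rw [← not_le] at hℓk ⊢
    exact fun h => hℓk ((logb_two_le_natCast_iff hk1).2 h)
  refine ⟨le_genTuranDensity_hypercube hℓn.le hmn.le h2m, ?_⟩
  refine (genTuranDensity_hypercube_le (by omega) hℓ hℓn.le).trans ?_
  have hn1 : (1 : ℝ) ≤ n := by exact_mod_cast (by omega : 1 ≤ n)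
  have hℓk' : ℓ ≤ 2 * k := (Nat.lt_two_pow_self.trans h2ℓ).le
  have hpow : (ℓ : ℝ) ^ ℓ ≤ (2 * k : ℝ) ^ (2 * k) := by
    exact_mod_cast (Nat.pow_le_pow_left hℓk' ℓ).trans
      (Nat.pow_le_pow_right (by omega) hℓk')
  have hinv : (n : ℝ)⁻¹ ≤ (n : ℝ) ^ (-(1 / 16 : ℝ)) := by
    rw [← Real.rpow_neg_one]
    exact Real.rpow_le_rpow_of_exponent_le hn1 (by norm_num)
  gcongr
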